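/- For a homeomorphism $f:\mathbb{R}^n\to\mathbb{R}^n$ and $x\in\mathbb{R}^n$ let \[ H(x,f)=\limsup_{r\to 0^+}\frac{\max_{|x-y|=r}|f(x)-f(y)|}{\min_{|x-y|=r}|f(x)-f(y)|}. \] If $H(\cdot,f)$ is bounded on $\mathbb{R}^n$, put $H(f)=\|H(\cdot,f)\|_{L^\infty(\mathbb{R}^n)}$ (essential supremum with respect to Lebesgue measure); then $f$ is called $H$-quasiconformal with $H=H(f)$. **Theorem.** Let $n\ge 3$ and $\alpha<\sqrt{2}$. Then there are a real number $H$, a sequence of $H$-quasiconformal mappings $f_j:\mathbb{R}^n\to\mathbb{R}^n$, so that $H(x,f_j)\le H$ for almost every $x\in\mathbb{R}^n$ and every $j$, and a quasiconformal affine mapping $A:\mathbb{R}^n\to\mathbb{R}^n$ such that $f_j\to A$ locally uniformly on $\mathbb{R}^n$ and \[ H(A)=H(x,A)\ \ge\ \alpha H\qquad\text{for every } x\in\mathbb{R}^n. \] Moreover, the gap can be arbitrarily large: given any $M\in\mathbb{R}$, the number $H$ and the mappings $f_j$ and $A$ can be chosen so that in addition $H(A)-H\ge M$. -/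

import Mathlib

open Filter Topology MeasureTheory
open scoped ENNReal

/-- The pointwise linear distortion
`H(x, f) = limsup_{r → 0+} (max_{|x-y|=r} |f x - f y|) / (min_{|x-y|=r} |f x - f y|)`
of a map `f : ℝⁿ → ℝⁿ`, with values in `[0, ∞]`. For a homeomorphism the supremum and the infimum
are attained (spheres are compact), and both are positive and finite. -/
noncomputable def pointLinearDistortion {n : ℕ}
    (f : EuclideanSpace ℝ (Fin n) → EuclideanSpace ℝ (Fin n)) (x : EuclideanSpace ℝ (Fin n)) :
    ℝ≥0∞ :=
  limsup (fun r : ℝ =>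
    (⨆ y ∈ Metric.sphere x r, edist (f x) (f y)) / (⨅ y ∈ Metric.sphere x r, edist (f x) (f y)))
    (𝓝[>] (0 : ℝ))

/-- The linear distortion `H(f) = ‖H(·, f)‖_{L^∞(ℝⁿ)}`: the essential supremum of the pointwise
linear distortion with respect to Lebesgue measure. -/
noncomputable def linearDistortion {n : ℕ}
    (f : EuclideanSpace ℝ (Fin n) → EuclideanSpace ℝ (Fin n)) : ℝ≥0∞ :=
  essSup (pointLinearDistortion f) volume

/-- `f : ℝⁿ → ℝⁿ` is `H`-quasiconformal: it is a homeomorphism, its pointwise linear distortion is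
bounded on `ℝⁿ` (at every point), and its linear distortion `H(f)` is the real number `H`. -/
structure IsQuasiconformal {n : ℕ} (H : ℝ)
    (f : EuclideanSpace ℝ (Fin n) → EuclideanSpace ℝ (Fin n)) : Prop where
  isHomeomorph : IsHomeomorph f
  bounded : ∃ C : ℝ, ∀ x, pointLinearDistortion f x ≤ ENNReal.ofReal C
  linearDistortion_eq : linearDistortion f = ENNReal.ofReal H

/-! The construction is a laminate: two gradients of distortion at most `k ^ 2` have an average of
distortion at least `2 * k ^ 2`. Let `D` stretch by `k ^ 2` in every direction except `e 2`, which
it fixes, let `ℓ` be `layerHeight` and let `a` be the vector multiplying `d` in `layerIncrement`.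
The layered map is `x ↦ D x + ψ (ℓ x) • a`. Since `ℓ (D⁻¹ a) = 0`, it is `D` composed with a shear,
hence a homeomorphism for every Lipschitz `ψ`.

Where `ψ` has slope 0 the differential is `D`, of distortion `k ^ 2`. With slope 2 the weak
direction `e 2` is stretched by a multiple of `k`, so the distortion is only `O(k)`
(`le_norm_layerIncrement_two`). With slope 1 a vector of norm at least `1 / 2` is sent to the unit
vector `e 2`, while `e 0` is stretched by at least `4 * k ^ 2`
(`two_mul_sq_le_pointLinearDistortion_layerMap_id`). Fine sawtooth profiles with slopes 0 and 2
converge uniformly to the identity profile of slope 1; taking `k` large makes the gap as large as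
desired. -/

/-- The increment identity behind all distortion estimates for the layered maps below: `h` is the
increment of the argument and `d` that of the profile. -/
noncomputable def layerIncrement {E : Type*} [NormedAddCommGroup E] [InnerProductSpace ℝ E]
    (k : ℝ) (e : Fin 3 → E) (h : E) (d : ℝ) : E :=
  k ^ 2 • h - ((k ^ 2 - 1) * inner ℝ (e 2) h) • e 2 +
    d • (-(k ^ 2 / 2) • e 0 + (4 * k ^ 2) • e 1 + (k / 2) • e 2)

/-- The linear functional whose level sets are the layers. -/
noncomputable def layerHeight {E : Type*} [NormedAddCommGroup E] [InnerProductSpace ℝ E]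
    (k : ℝ) (e : Fin 3 → E) : E →L[ℝ] ℝ :=
  innerSL ℝ (e 0 + k⁻¹ • e 2)

/-- The layered map with profile `ψ`: a diagonal stretching composed with a shear. -/
noncomputable def layerMap {E : Type*} [NormedAddCommGroup E] [InnerProductSpace ℝ E]
    (k : ℝ) (e : Fin 3 → E) (ψ : ℝ → ℝ) (x : E) : E :=
  layerIncrement k e x (ψ (layerHeight k e x))

/-! ### Algebra and norm bounds for layered maps. -/

section Layer

variable {E : Type*} [NormedAddCommGroup E] [InnerProductSpace ℝ E] {k : ℝ} {e : Fin 3 → E}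

lemma layerHeight_apply (x : E) :
    layerHeight k e x = inner ℝ (e 0) x + k⁻¹ * inner ℝ (e 2) x := by
  simp [layerHeight]

lemma layerMap_sub (ψ : ℝ → ℝ) (x y : E) :
    layerMap k e ψ x - layerMap k e ψ y =
      layerIncrement k e (x - y) (ψ (layerHeight k e x) - ψ (layerHeight k e y)) := by
  simp only [layerMap, layerIncrement, inner_sub_right]
  module

lemma Orthonormal.inner_fin_three (he : Orthonormal ℝ e) (i j : Fin 3) :
    inner ℝ (e i) (e j) = if i = j then (1 : ℝ) else 0 :=
  orthonormal_iff_ite.mp he i j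

lemma Orthonormal.abs_inner_le (he : Orthonormal ℝ e) (i : Fin 3) (x : E) :
    |inner ℝ (e i) x| ≤ ‖x‖ := by
  simpa [he.1 i] using abs_real_inner_le_norm (e i) x

lemma inner_zero_layerIncrement (he : Orthonormal ℝ e) (h : E) (d : ℝ) :
    inner ℝ (e 0) (layerIncrement k e h d) = k ^ 2 * inner ℝ (e 0) h - d * (k ^ 2 / 2) := by
  simp [layerIncrement, inner_add_right, inner_sub_right, inner_smul_right, he.inner_fin_three,
    -inner_self_eq_norm_sq_to_K]
  ring

lemma inner_one_layerIncrement (he : Orthonormal ℝ e) (h : E) (d : ℝ) :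
    inner ℝ (e 1) (layerIncrement k e h d) = k ^ 2 * inner ℝ (e 1) h + d * (4 * k ^ 2) := by
  simp [layerIncrement, inner_add_right, inner_sub_right, inner_smul_right, he.inner_fin_three,
    -inner_self_eq_norm_sq_to_K]

lemma inner_two_layerIncrement (he : Orthonormal ℝ e) (h : E) (d : ℝ) :
    inner ℝ (e 2) (layerIncrement k e h d) = inner ℝ (e 2) h + d * (k / 2) := by
  simp [layerIncrement, inner_add_right, inner_sub_right, inner_smul_right, he.inner_fin_three,
    -inner_self_eq_norm_sq_to_K]
  ring

/-- The vector multiplying `d` is killed by `ℓ ∘ D⁻¹`, so the height is recovered from the image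
whatever `d` is. -/
lemma layerHeight_eq_of_layerIncrement (he : Orthonormal ℝ e) (hk : 1 ≤ k) (h : E) (d : ℝ) :
    layerHeight k e h = (k ^ 2)⁻¹ * inner ℝ (e 0) (layerIncrement k e h d) +
      k⁻¹ * inner ℝ (e 2) (layerIncrement k e h d) := by
  rw [inner_zero_layerIncrement he, inner_two_layerIncrement he, layerHeight_apply]
  have : k ≠ 0 := by positivity
  field_simp
  ring

lemma norm_layerVector_le (he : Orthonormal ℝ e) (hk : 1 ≤ k) :
    ‖-(k ^ 2 / 2) • e 0 + (4 * k ^ 2) • e 1 + (k / 2) • e 2‖ ≤ 5 * k ^ 2 := by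
  refine (norm_add₃_le).trans ?_
  simp only [norm_smul, he.1, Real.norm_eq_abs, abs_neg]
  rw [abs_of_nonneg (by positivity), abs_of_nonneg (by positivity), abs_of_nonneg (by positivity)]
  nlinarith

lemma abs_layerHeight_le (he : Orthonormal ℝ e) (hk : 1 ≤ k) (x : E) :
    |layerHeight k e x| ≤ 2 * ‖x‖ := by
  have h0 := he.abs_inner_le 0 x
  have h2 := he.abs_inner_le 2 x
  have hk' : k⁻¹ ≤ 1 := inv_le_one_of_one_le₀ hk
  have hk0 : 0 ≤ k⁻¹ := by positivity
  rw [layerHeight_apply]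
  refine (abs_add_le _ _).trans ?_
  rw [abs_mul, abs_of_nonneg hk0]
  nlinarith [abs_nonneg (inner ℝ (e 2) x)]

lemma abs_layerHeight_le_norm_layerIncrement (he : Orthonormal ℝ e) (hk : 1 ≤ k) (h : E) (d : ℝ) :
    k * |layerHeight k e h| ≤ 2 * ‖layerIncrement k e h d‖ := by
  have h0 := he.abs_inner_le 0 (layerIncrement k e h d)
  have h2 := he.abs_inner_le 2 (layerIncrement k e h d)
  have hk' : k⁻¹ ≤ 1 := inv_le_one_of_one_le₀ hk
  have hk0 : 0 < k := by positivity
  have hk1 : 0 ≤ k⁻¹ := by positivity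
  rw [← abs_of_pos hk0, ← abs_mul, abs_of_pos hk0]
  have : k * layerHeight k e h = k⁻¹ * inner ℝ (e 0) (layerIncrement k e h d) +
      inner ℝ (e 2) (layerIncrement k e h d) := by
    rw [layerHeight_eq_of_layerIncrement he hk h d]
    field_simp
  rw [this]
  refine (abs_add_le _ _).trans ?_
  rw [abs_mul, abs_of_nonneg hk1]
  nlinarith [abs_nonneg (inner ℝ (e 0) (layerIncrement k e h d))]

lemma norm_sq_layerIncrement_zero (he : Orthonormal ℝ e) (h : E) :
    ‖layerIncrement k e h 0‖ ^ 2 =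
      k ^ 4 * ‖h‖ ^ 2 - (k ^ 4 - 1) * inner ℝ (e 2) h ^ 2 := by
  simp only [layerIncrement, zero_smul, add_zero]
  rw [norm_sub_sq_real, norm_smul, norm_smul, he.1, inner_smul_left, inner_smul_right,
    real_inner_comm, mul_pow, mul_pow, Real.norm_eq_abs, Real.norm_eq_abs, sq_abs, sq_abs]
  simp
  ring

lemma norm_layerIncrement_zero_le (he : Orthonormal ℝ e) (hk : 1 ≤ k) (h : E) :
    ‖layerIncrement k e h 0‖ ≤ k ^ 2 * ‖h‖ := by
  refine (sq_le_sq₀ (by positivity) (by positivity)).1 ?_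
  rw [norm_sq_layerIncrement_zero he]
  have : 1 ≤ k ^ 4 := one_le_pow₀ hk
  nlinarith [sq_nonneg (inner ℝ (e 2) h)]

lemma le_norm_layerIncrement_zero (he : Orthonormal ℝ e) (hk : 1 ≤ k) (h : E) :
    ‖h‖ ≤ ‖layerIncrement k e h 0‖ := by
  refine (sq_le_sq₀ (by positivity) (by positivity)).1 ?_
  rw [norm_sq_layerIncrement_zero he]
  have : 1 ≤ k ^ 4 := one_le_pow₀ hk
  have h2 : inner ℝ (e 2) h ^ 2 ≤ ‖h‖ ^ 2 := sq_le_sq' (abs_le.mp (he.abs_inner_le 2 h)).1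
    (abs_le.mp (he.abs_inner_le 2 h)).2
  nlinarith

lemma norm_layerIncrement_le (he : Orthonormal ℝ e) (hk : 1 ≤ k) {h : E} {d : ℝ}
    (hd : |d| ≤ 2 * |layerHeight k e h|) :
    ‖layerIncrement k e h d‖ ≤ 21 * k ^ 2 * ‖h‖ := by
  have h1 : layerIncrement k e h d = layerIncrement k e h 0 +
      d • (-(k ^ 2 / 2) • e 0 + (4 * k ^ 2) • e 1 + (k / 2) • e 2) := by
    simp [layerIncrement]
  rw [h1]
  refine (norm_add_le _ _).trans ?_
  rw [norm_smul, Real.norm_eq_abs]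
  have h2 := norm_layerIncrement_zero_le he hk h
  have h3 : |d| * ‖-(k ^ 2 / 2) • e 0 + (4 * k ^ 2) • e 1 + (k / 2) • e 2‖ ≤
      4 * ‖h‖ * (5 * k ^ 2) :=
    mul_le_mul (by linarith [abs_layerHeight_le he hk h]) (norm_layerVector_le he hk)
      (norm_nonneg _) (by positivity)
  linarith

/-- Solving the increment formula for `k ^ 2 • h` leaves only the `e 2` component of `h` to be
controlled; the next two lemmas do this in two ways. -/
lemma norm_smul_le_layerIncrement (he : Orthonormal ℝ e) (hk : 1 ≤ k) {h : E} {d : ℝ}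
    (hd : |d| ≤ 2 * |layerHeight k e h|) :
    k ^ 2 * ‖h‖ ≤ (1 + 20 * k) * ‖layerIncrement k e h d‖ + k ^ 2 * |inner ℝ (e 2) h| := by
  have hk0 : 0 < k := by positivity
  have h1 : k ^ 2 • h = layerIncrement k e h d + ((k ^ 2 - 1) * inner ℝ (e 2) h) • e 2 -
      d • (-(k ^ 2 / 2) • e 0 + (4 * k ^ 2) • e 1 + (k / 2) • e 2) := by
    simp only [layerIncrement]
    module
  have h2 : k ^ 2 * ‖h‖ = ‖k ^ 2 • h‖ := by
    rw [norm_smul, Real.norm_of_nonneg (by positivity)]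
  rw [h2, h1]
  refine (norm_sub_le _ _).trans ?_
  refine (add_le_add_left (norm_add_le _ _) _).trans ?_
  rw [norm_smul, norm_smul, he.1, Real.norm_eq_abs, Real.norm_eq_abs, abs_mul,
    abs_of_nonneg (show 0 ≤ k ^ 2 - 1 by nlinarith)]
  have h3 : |d| * ‖-(k ^ 2 / 2) • e 0 + (4 * k ^ 2) • e 1 + (k / 2) • e 2‖ ≤
      |d| * (5 * k ^ 2) := by gcongr; exact norm_layerVector_le he hk
  have h4 := abs_layerHeight_le_norm_layerIncrement he hk h d
  have h5 : |d| * (5 * k ^ 2) ≤ 20 * k * ‖layerIncrement k e h d‖ := by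
    have : k * |d| ≤ 4 * ‖layerIncrement k e h d‖ := by nlinarith
    nlinarith
  nlinarith [abs_nonneg (inner ℝ (e 2) h)]

lemma le_norm_layerIncrement (he : Orthonormal ℝ e) (hk : 1 ≤ k) {h : E} {d : ℝ}
    (hd : |d| ≤ 2 * |layerHeight k e h|) :
    ‖h‖ ≤ 24 * ‖layerIncrement k e h d‖ := by
  have hk0 : 0 < k := by positivity
  have h1 := norm_smul_le_layerIncrement he hk hd
  have h4 := abs_layerHeight_le_norm_layerIncrement he hk h d
  have h2 := he.abs_inner_le 2 (layerIncrement k e h d)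
  have h3 : |inner ℝ (e 2) h| ≤ 3 * ‖layerIncrement k e h d‖ := by
    have : inner ℝ (e 2) h = inner ℝ (e 2) (layerIncrement k e h d) - d * (k / 2) := by
      rw [inner_two_layerIncrement he]; ring
    rw [this]
    refine (abs_sub _ _).trans ?_
    rw [abs_mul, abs_of_pos (half_pos hk0)]
    nlinarith
  have h5 : k ^ 2 * ‖h‖ ≤ k ^ 2 * (24 * ‖layerIncrement k e h d‖) := by
    nlinarith [norm_nonneg (layerIncrement k e h d), mul_nonneg (sub_nonneg.2 hk)
      (norm_nonneg (layerIncrement k e h d)), mul_nonneg (mul_nonneg hk0.le (sub_nonneg.2 hk))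
      (norm_nonneg (layerIncrement k e h d))]
  exact le_of_mul_le_mul_left h5 (by positivity)

/-- At slope exactly 2 the `e 0` component of the image collapses to `-k * inner ℝ (e 2) h`, which
gains a factor `k` over the general bound. -/
lemma le_norm_layerIncrement_two (he : Orthonormal ℝ e) (hk : 1 ≤ k) (h : E) :
    k * ‖h‖ ≤ 22 * ‖layerIncrement k e h (2 * layerHeight k e h)‖ := by
  have hk0 : 0 < k := by positivity
  have h1 := norm_smul_le_layerIncrement (h := h) (d := 2 * layerHeight k e h) he hk
    (by simp [abs_mul])
  set z := layerIncrement k e h (2 * layerHeight k e h) with hz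
  have h2 := he.abs_inner_le 0 z
  have h3 : k * |inner ℝ (e 2) h| ≤ ‖z‖ := by
    have : inner ℝ (e 0) z = -(k * inner ℝ (e 2) h) := by
      rw [hz, inner_zero_layerIncrement he, layerHeight_apply]
      field_simp
      ring
    rw [this, abs_neg, abs_mul, abs_of_pos hk0] at h2
    exact h2
  have h5 : k * (k * ‖h‖) ≤ k * (22 * ‖z‖) := by
    nlinarith [norm_nonneg z]
  exact le_of_mul_le_mul_left h5 hk0

lemma abs_sub_le_abs_layerHeight {ψ : ℝ → ℝ} (hψ : ∀ s t, |ψ s - ψ t| ≤ 2 * |s - t|) (x y : E) :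
    |ψ (layerHeight k e x) - ψ (layerHeight k e y)| ≤ 2 * |layerHeight k e (x - y)| := by
  simpa using hψ (layerHeight k e x) (layerHeight k e y)

lemma layerMap_isHomeomorph (he : Orthonormal ℝ e) (hk : 1 ≤ k) {ψ : ℝ → ℝ}
    (hψ : ∀ s t, |ψ s - ψ t| ≤ 2 * |s - t|) : IsHomeomorph (layerMap k e ψ) := by
  have hk0 : k ≠ 0 := by positivity
  have hψc : Continuous ψ := by
    refine (LipschitzWith.of_dist_le_mul (K := 2) fun s t => ?_).continuous
    simpa [Real.dist_eq] using hψ s t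
  have hc : Continuous (layerMap k e ψ) := by
    unfold layerMap layerIncrement
    fun_prop
  have ha : AntilipschitzWith 24 (layerMap k e ψ) := by
    refine AntilipschitzWith.of_le_mul_dist fun x y => ?_
    rw [dist_eq_norm, dist_eq_norm, layerMap_sub]
    exact le_norm_layerIncrement he hk (abs_sub_le_abs_layerHeight hψ x y)
  -- The inverse is `D⁻¹ z - ψ (ℓ (D⁻¹ z)) • D⁻¹ a`, the shear being undone at unchanged height.
  let g : E → E := fun z => (k ^ 2)⁻¹ • z + ((1 - (k ^ 2)⁻¹) * inner ℝ (e 2) z) • e 2 -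
    ψ ((k ^ 2)⁻¹ * inner ℝ (e 0) z + k⁻¹ * inner ℝ (e 2) z) •
      ((-1 / 2 : ℝ) • e 0 + (4 : ℝ) • e 1 + (k / 2) • e 2)
  have hg : Continuous g := by fun_prop
  have hr : Function.RightInverse g (layerMap k e ψ) := by
    intro z
    have h0 : inner ℝ (e 0) (g z) = (k ^ 2)⁻¹ * inner ℝ (e 0) z +
        ψ ((k ^ 2)⁻¹ * inner ℝ (e 0) z + k⁻¹ * inner ℝ (e 2) z) / 2 := by
      simp [g, inner_add_right, inner_sub_right, inner_smul_right, he.inner_fin_three,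
        -inner_self_eq_norm_sq_to_K]
      ring
    have h2 : inner ℝ (e 2) (g z) = inner ℝ (e 2) z -
        ψ ((k ^ 2)⁻¹ * inner ℝ (e 0) z + k⁻¹ * inner ℝ (e 2) z) * (k / 2) := by
      simp [g, inner_add_right, inner_sub_right, inner_smul_right, he.inner_fin_three,
        -inner_self_eq_norm_sq_to_K]
      ring
    have hh : layerHeight k e (g z) = (k ^ 2)⁻¹ * inner ℝ (e 0) z + k⁻¹ * inner ℝ (e 2) z := by
      rw [layerHeight_apply, h0, h2]
      field_simp
      ring
    rw [layerMap, layerIncrement, hh, h2]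
    simp only [g]
    match_scalars <;> field_simp <;> ring
  exact (Homeomorph.mk ⟨layerMap k e ψ, g, hr.leftInverse_of_injective ha.injective, hr⟩ hc
    hg).isHomeomorph

end Layer

/-! ### General bounds for the pointwise and essential distortion. -/

section Distortion

variable {n : ℕ} {f : EuclideanSpace ℝ (Fin n) → EuclideanSpace ℝ (Fin n)}
  {x : EuclideanSpace ℝ (Fin n)}

lemma pointLinearDistortion_le {m P : ℝ} (hm : 0 < m)
    (h : ∀ᶠ y in 𝓝 x, m * ‖x - y‖ ≤ ‖f x - f y‖ ∧ ‖f x - f y‖ ≤ P * ‖x - y‖) :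
    pointLinearDistortion f x ≤ ENNReal.ofReal (P / m) := by
  obtain ⟨ε, hε, hb⟩ := Metric.eventually_nhds_iff.mp h
  refine limsup_le_of_le (by isBoundedDefault) ?_
  filter_upwards [Ioo_mem_nhdsGT hε] with r hr
  have hxy : ∀ y ∈ Metric.sphere x r, ‖x - y‖ = r := fun y hy => by
    rw [← dist_eq_norm, dist_comm]; exact hy
  have hy' : ∀ y ∈ Metric.sphere x r, m * r ≤ ‖f x - f y‖ ∧ ‖f x - f y‖ ≤ P * r := fun y hy => by
    have := @hb y (by rw [Metric.mem_sphere.mp hy]; exact hr.2)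
    rwa [hxy y hy] at this
  have h1 : (⨆ y ∈ Metric.sphere x r, edist (f x) (f y)) ≤ ENNReal.ofReal (P * r) :=
    iSup₂_le fun y hy => by
      rw [edist_dist, dist_eq_norm]; exact ENNReal.ofReal_le_ofReal (hy' y hy).2
  have h2 : ENNReal.ofReal (m * r) ≤ ⨅ y ∈ Metric.sphere x r, edist (f x) (f y) :=
    le_iInf₂ fun y hy => by
      rw [edist_dist, dist_eq_norm]; exact ENNReal.ofReal_le_ofReal (hy' y hy).1
  refine (ENNReal.div_le_div h1 h2).trans ?_
  rw [← ENNReal.ofReal_div_of_pos (mul_pos hm hr.1), mul_div_mul_right _ _ hr.1.ne']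

/-- Near `x` the map is exactly homogeneous, so the directions `u` and `v` on each small sphere
bound the maximum from below and the minimum from above. -/
lemma le_pointLinearDistortion {L : EuclideanSpace ℝ (Fin n) → EuclideanSpace ℝ (Fin n)}
    (hL : ∀ (c : ℝ) y, L (c • y) = c • L y) (h : ∀ᶠ y in 𝓝 x, f y - f x = L (y - x))
    {u v : EuclideanSpace ℝ (Fin n)} (hu : u ≠ 0) (hv : v ≠ 0) (hLv : L v ≠ 0) :
    ENNReal.ofReal ((‖L u‖ / ‖u‖) / (‖L v‖ / ‖v‖)) ≤ pointLinearDistortion f x := by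
  obtain ⟨ε, hε, hb⟩ := Metric.eventually_nhds_iff.mp h
  refine le_limsup_of_frequently_le (Eventually.frequently ?_) (by isBoundedDefault)
  filter_upwards [Ioo_mem_nhdsGT hε] with r hr
  have key : ∀ w : EuclideanSpace ℝ (Fin n), w ≠ 0 → x + (r / ‖w‖) • w ∈ Metric.sphere x r ∧
      edist (f x) (f (x + (r / ‖w‖) • w)) = ENNReal.ofReal (‖L w‖ / ‖w‖ * r) := fun w hw => by
    have hw' : ‖w‖ ≠ 0 := norm_ne_zero_iff.mpr hw
    have hs : dist (x + (r / ‖w‖) • w) x = r := by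
      rw [dist_eq_norm, add_sub_cancel_left, norm_smul, norm_div, norm_norm,
        Real.norm_of_nonneg hr.1.le, div_mul_cancel₀ _ hw']
    refine ⟨hs, ?_⟩
    rw [edist_dist, dist_comm, dist_eq_norm, @hb _ (by rw [hs]; exact hr.2), add_sub_cancel_left,
      hL, norm_smul, norm_div, norm_norm, Real.norm_of_nonneg hr.1.le]
    congr 1
    ring
  have hv0 : 0 < ‖L v‖ / ‖v‖ * r :=
    mul_pos (div_pos (norm_pos_iff.mpr hLv) (norm_pos_iff.mpr hv)) hr.1
  calc ENNReal.ofReal ((‖L u‖ / ‖u‖) / (‖L v‖ / ‖v‖))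
      = ENNReal.ofReal (‖L u‖ / ‖u‖ * r) / ENNReal.ofReal (‖L v‖ / ‖v‖ * r) := by
        rw [← ENNReal.ofReal_div_of_pos hv0, mul_div_mul_right _ _ hr.1.ne']
    _ ≤ _ := by
        refine ENNReal.div_le_div ?_ ?_
        · rw [← (key u hu).2]
          exact le_iSup₂_of_le _ (key u hu).1 le_rfl
        · rw [← (key v hv).2]
          exact iInf₂_le _ (key v hv).1

lemma pointLinearDistortion_eq_zero_point
    (A : EuclideanSpace ℝ (Fin n) →ᵃ[ℝ] EuclideanSpace ℝ (Fin n))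
    (x : EuclideanSpace ℝ (Fin n)) :
    pointLinearDistortion A x = pointLinearDistortion A 0 := by
  have hA : ∀ y, edist (A x) (A (x + y)) = edist (A 0) (A y) := fun y => by
    have h1 := A.map_vadd x y
    have h2 := A.map_vadd 0 y
    simp only [vadd_eq_add, add_zero] at h1 h2
    rw [add_comm x, h1, h2, edist_eq_enorm_sub, edist_eq_enorm_sub]
    congr 1
    abel
  have hs : ∀ (r : ℝ) y, x + y ∈ Metric.sphere x r ↔ y ∈ Metric.sphere 0 r := by
    simp
  unfold pointLinearDistortion
  congr 1
  funext r
  congr 1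
  · rw [← (Equiv.addLeft x).iSup_comp]
    simp only [Equiv.coe_addLeft, hs, hA]
  · rw [← (Equiv.addLeft x).iInf_comp]
    simp only [Equiv.coe_addLeft, hs, hA]

lemma le_essSup_of_isOpen {g : EuclideanSpace ℝ (Fin n) → ℝ≥0∞} {c : ℝ≥0∞}
    {U : Set (EuclideanSpace ℝ (Fin n))} (hU : IsOpen U) (hne : U.Nonempty)
    (h : ∀ x ∈ U, c ≤ g x) : c ≤ essSup g volume := by
  by_contra! hlt
  have hz : volume U = 0 := by
    refine measure_mono_null (fun x hx => ?_) (ae_iff.mp (ae_lt_of_essSup_lt hlt))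
    simpa using h x hx
  exact (hU.measure_pos volume hne).ne' hz

end Distortion

/-! ### Sawtooth profiles and their local slopes. -/

/-- A sawtooth perturbation of the identity whose slopes are `2` and `0`. -/
noncomputable def sawtooth (s : ℝ) : ℝ := s + |s - round s|

lemma abs_sub_round_sub_le (s t : ℝ) : |s - round s| - |t - round t| ≤ |s - t| := by
  have h1 : |s - round s| ≤ |s - round t| := round_le s (round t)
  have h2 : |s - round t| ≤ |s - t| + |t - round t| := abs_sub_le _ _ _
  linarith

lemma abs_sawtooth_sub_le (s t : ℝ) : |sawtooth s - sawtooth t| ≤ 2 * |s - t| := by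
  have h1 := abs_sub_round_sub_le s t
  have h2 := abs_sub_round_sub_le t s
  rw [abs_sub_comm t s] at h2
  have h3 := le_abs_self (s - t)
  have h4 := neg_abs_le (s - t)
  unfold sawtooth
  rw [abs_le]
  constructor <;> linarith

lemma sawtooth_eq_of_mem {m : ℤ} {s : ℝ} (h : |s - m| < 1 / 2) : sawtooth s = s + |s - m| := by
  have : round s = m := by
    rw [round_eq, Int.floor_eq_iff]
    rw [abs_lt] at h
    constructor <;> linarith
  rw [sawtooth, this]

lemma sawtooth_eventually_slope_zero {m : ℤ} {s : ℝ} (h1 : (m : ℝ) - 1 / 2 < s) (h2 : s < m) :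
    ∀ᶠ t in 𝓝 s, sawtooth t - sawtooth s = 0 := by
  have key : ∀ t ∈ Set.Ioo ((m : ℝ) - 1 / 2) m, sawtooth t = m := fun t ht => by
    rw [sawtooth_eq_of_mem (m := m), abs_of_neg (by linarith [ht.2])]
    · ring
    · rw [abs_lt]; constructor <;> linarith [ht.1, ht.2]
  filter_upwards [Ioo_mem_nhds h1 h2] with t ht
  rw [key t ht, key s ⟨h1, h2⟩, sub_self]

lemma sawtooth_eventually_slope_two {m : ℤ} {s : ℝ} (h1 : (m : ℝ) < s) (h2 : s < m + 1 / 2) :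
    ∀ᶠ t in 𝓝 s, sawtooth t - sawtooth s = 2 * (t - s) := by
  have key : ∀ t ∈ Set.Ioo (m : ℝ) (m + 1 / 2), sawtooth t = 2 * t - m := fun t ht => by
    rw [sawtooth_eq_of_mem (m := m), abs_of_pos (by linarith [ht.1])]
    · ring
    · rw [abs_lt]; constructor <;> linarith [ht.1, ht.2]
  filter_upwards [Ioo_mem_nhds h1 h2] with t ht
  rw [key t ht, key s ⟨h1, h2⟩]
  ring

/-- Kinks occur only at half-integers. -/
lemma sawtooth_eventually_slope {s : ℝ} (hs : ∀ m : ℤ, s ≠ m / 2) :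
    (∀ᶠ t in 𝓝 s, sawtooth t - sawtooth s = 0) ∨
      ∀ᶠ t in 𝓝 s, sawtooth t - sawtooth s = 2 * (t - s) := by
  have h1 : (⌊s⌋ : ℝ) < s := lt_of_le_of_ne (Int.floor_le s) fun h => hs (2 * ⌊s⌋) <| by
    push_cast; linarith
  have h2 := Int.lt_floor_add_one s
  have h3 : s ≠ ⌊s⌋ + 1 / 2 := fun h => hs (2 * ⌊s⌋ + 1) <| by push_cast; linarith
  rcases lt_or_gt_of_ne h3 with h | h
  · exact Or.inr (sawtooth_eventually_slope_two h1 h)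
  · refine Or.inl (sawtooth_eventually_slope_zero (m := ⌊s⌋ + 1) ?_ ?_) <;> push_cast <;> linarith

/-- The sawtooth at scale `(j + 1)⁻¹`. -/
noncomputable def scaledSawtooth (j : ℕ) (s : ℝ) : ℝ := sawtooth ((j + 1) * s) / (j + 1)

lemma abs_scaledSawtooth_sub_le (j : ℕ) (s t : ℝ) :
    |scaledSawtooth j s - scaledSawtooth j t| ≤ 2 * |s - t| := by
  have hj : (0 : ℝ) < j + 1 := by positivity
  have h := abs_sawtooth_sub_le ((j + 1) * s) ((j + 1) * t)
  rw [← mul_sub, abs_mul, abs_of_pos hj] at h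
  rw [scaledSawtooth, scaledSawtooth, ← sub_div, abs_div, abs_of_pos hj, div_le_iff₀ hj]
  linarith

lemma abs_scaledSawtooth_sub_self_le (j : ℕ) (s : ℝ) :
    |scaledSawtooth j s - s| ≤ 1 / (j + 1) := by
  have hj : (0 : ℝ) < j + 1 := by positivity
  have : scaledSawtooth j s - s = |(j + 1) * s - round ((j + 1) * s)| / (j + 1) := by
    rw [scaledSawtooth, sawtooth]
    field_simp
    ring
  rw [this, abs_div, abs_abs, abs_of_pos hj]
  gcongr
  linarith [abs_sub_round ((j + 1) * s)]

lemma scaledSawtooth_eventually {j : ℕ} {s c : ℝ}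
    (h : ∀ᶠ t in 𝓝 ((j + 1) * s), sawtooth t - sawtooth ((j + 1) * s) = c * (t - (j + 1) * s)) :
    ∀ᶠ t in 𝓝 s, scaledSawtooth j t - scaledSawtooth j s = c * (t - s) := by
  have hc : Tendsto (fun t : ℝ => ((j : ℝ) + 1) * t) (𝓝 s) (𝓝 ((j + 1) * s)) :=
    (continuous_const.mul continuous_id).tendsto s
  have hj : (j : ℝ) + 1 ≠ 0 := by positivity
  filter_upwards [hc.eventually h] with t ht
  rw [scaledSawtooth, scaledSawtooth, ← sub_div, ht]
  field_simp

/-! ### Distortion of the layered maps and of their affine limit. -/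

section LayerDistortion

variable {n : ℕ} {k : ℝ} {e : Fin 3 → EuclideanSpace ℝ (Fin n)}

lemma layerHeight_apply_zero {E : Type*} [NormedAddCommGroup E] [InnerProductSpace ℝ E]
    {e : Fin 3 → E} (he : Orthonormal ℝ e) (k : ℝ) : layerHeight k e (e 0) = 1 := by
  rw [layerHeight_apply]
  simp [he.inner_fin_three, -inner_self_eq_norm_sq_to_K]

/-- This cruder bound also covers points on the creases, where no local slope exists. -/
lemma pointLinearDistortion_layerMap_le (he : Orthonormal ℝ e) (hk : 1 ≤ k) {ψ : ℝ → ℝ}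
    (hψ : ∀ s t, |ψ s - ψ t| ≤ 2 * |s - t|) (x : EuclideanSpace ℝ (Fin n)) :
    pointLinearDistortion (layerMap k e ψ) x ≤ ENNReal.ofReal (21 * k ^ 2 / (1 / 24)) := by
  refine pointLinearDistortion_le (by norm_num) (Eventually.of_forall fun y => ?_)
  rw [layerMap_sub]
  have h := abs_sub_le_abs_layerHeight (k := k) (e := e) hψ x y
  exact ⟨by linarith [le_norm_layerIncrement he hk h], norm_layerIncrement_le he hk h⟩

lemma layerMap_eventually {ψ : ℝ → ℝ} {c : ℝ} {x : EuclideanSpace ℝ (Fin n)}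
    (h : ∀ᶠ t in 𝓝 (layerHeight k e x), ψ t - ψ (layerHeight k e x) =
      c * (t - layerHeight k e x)) :
    ∀ᶠ y in 𝓝 x, layerMap k e ψ y - layerMap k e ψ x =
      layerIncrement k e (y - x) (c * layerHeight k e (y - x)) := by
  filter_upwards [((layerHeight k e).continuous.tendsto x).eventually h] with y hy
  rw [layerMap_sub, hy, map_sub]

lemma layerIncrement_smul (c t : ℝ) (y : EuclideanSpace ℝ (Fin n)) :
    layerIncrement k e (t • y) (c * layerHeight k e (t • y)) =
      t • layerIncrement k e y (c * layerHeight k e y) := by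
  simp only [layerIncrement, map_smul, inner_smul_right, smul_eq_mul]
  module

lemma pointLinearDistortion_layerMap_le_sq (he : Orthonormal ℝ e) (hk : 462 ≤ k) {ψ : ℝ → ℝ}
    {x : EuclideanSpace ℝ (Fin n)}
    (h : (∀ᶠ t in 𝓝 (layerHeight k e x), ψ t - ψ (layerHeight k e x) =
        0 * (t - layerHeight k e x)) ∨
      ∀ᶠ t in 𝓝 (layerHeight k e x), ψ t - ψ (layerHeight k e x) =
        2 * (t - layerHeight k e x)) :
    pointLinearDistortion (layerMap k e ψ) x ≤ ENNReal.ofReal (k ^ 2) := by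
  have hk1 : 1 ≤ k := by linarith
  have hk0 : 0 < k := by linarith
  rcases h with h | h
  · rw [← div_one (k ^ 2)]
    refine pointLinearDistortion_le one_pos ?_
    filter_upwards [layerMap_eventually h] with y hy
    rw [norm_sub_rev x, norm_sub_rev (layerMap k e ψ x), hy, zero_mul, one_mul]
    exact ⟨le_norm_layerIncrement_zero he hk1 _, norm_layerIncrement_zero_le he hk1 _⟩
  · refine (pointLinearDistortion_le (m := k / 22) (P := 21 * k ^ 2) (by positivity) ?_).trans
      (ENNReal.ofReal_le_ofReal ?_)
    · filter_upwards [layerMap_eventually h] with y hy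
      rw [norm_sub_rev x, norm_sub_rev (layerMap k e ψ x), hy]
      exact ⟨by linarith [le_norm_layerIncrement_two he hk1 (y - x)],
        norm_layerIncrement_le he hk1 (by simp [abs_mul])⟩
    -- The quotient is `21 * 22 * k = 462 * k`, whence the threshold on `k`.
    · rw [div_le_iff₀ (by positivity)]
      nlinarith [mul_nonneg (sq_nonneg k) (sub_nonneg.2 hk)]

lemma sq_le_pointLinearDistortion_layerMap (he : Orthonormal ℝ e) {ψ : ℝ → ℝ}
    {x : EuclideanSpace ℝ (Fin n)}
    (h : ∀ᶠ t in 𝓝 (layerHeight k e x), ψ t - ψ (layerHeight k e x) =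
        0 * (t - layerHeight k e x)) :
    ENNReal.ofReal (k ^ 2) ≤ pointLinearDistortion (layerMap k e ψ) x := by
  have h0 : layerIncrement k e (e 0) 0 = k ^ 2 • e 0 := by
    simp [layerIncrement, he.inner_fin_three, -inner_self_eq_norm_sq_to_K]
  have h2 : layerIncrement k e (e 2) 0 = e 2 := by
    simp [layerIncrement, he.inner_fin_three, -inner_self_eq_norm_sq_to_K]
    module
  have := le_pointLinearDistortion
    (L := fun y => layerIncrement k e y (0 * layerHeight k e y)) (layerIncrement_smul 0)
    (layerMap_eventually h) (he.ne_zero 0) (he.ne_zero 2) (by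
      simpa only [zero_mul, h2] using he.ne_zero 2)
  simpa [h0, h2, he.1, norm_smul] using this

lemma two_mul_sq_le_pointLinearDistortion_layerMap_id (he : Orthonormal ℝ e) (hk : 1 ≤ k)
    (x : EuclideanSpace ℝ (Fin n)) :
    ENNReal.ofReal (2 * k ^ 2) ≤ pointLinearDistortion (layerMap k e id) x := by
  have hk0 : 0 < k := by linarith
  -- The preimage of `e 2` under the slope 1 differential; its height is `1 / k`.
  let w := (1 / (2 * k)) • e 0 + (-4 / k) • e 1 + (1 / 2 : ℝ) • e 2
  have hw0 : inner ℝ (e 0) w = 1 / (2 * k) := by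
    simp [w, inner_add_right, inner_smul_right, he.inner_fin_three, -inner_self_eq_norm_sq_to_K]
  have hw2 : inner ℝ (e 2) w = 1 / 2 := by
    simp [w, inner_add_right, inner_smul_right, he.inner_fin_three, -inner_self_eq_norm_sq_to_K]
  have hwn : 1 / 2 ≤ ‖w‖ := by
    have := he.abs_inner_le 2 w
    rwa [hw2, abs_of_pos (by norm_num)] at this
  have hw : w ≠ 0 := norm_pos_iff.mp (by linarith)
  have hLw : layerIncrement k e w (1 * layerHeight k e w) = e 2 := by
    rw [layerHeight_apply, layerIncrement, hw0, hw2]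
    simp only [w]
    match_scalars <;> field_simp <;> ring
  have hL0 : 4 * k ^ 2 ≤ ‖layerIncrement k e (e 0) (1 * layerHeight k e (e 0))‖ := by
    have := he.abs_inner_le 1 (layerIncrement k e (e 0) (1 * layerHeight k e (e 0)))
    rw [inner_one_layerIncrement he, he.inner_fin_three] at this
    refine le_trans (le_of_eq ?_) this
    simp [layerHeight_apply_zero he]
  have hev : ∀ᶠ t in 𝓝 (layerHeight k e x), id t - id (layerHeight k e x) =
      1 * (t - layerHeight k e x) := Eventually.of_forall fun t => by simp
  refine le_trans (ENNReal.ofReal_le_ofReal ?_) (le_pointLinearDistortion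
    (L := fun y => layerIncrement k e y (1 * layerHeight k e y)) (layerIncrement_smul 1)
    (layerMap_eventually hev) (he.ne_zero 0) hw (by
      simpa only [hLw] using he.ne_zero 2))
  rw [hLw, he.1, he.1, div_one, div_div_eq_mul_div, div_one]
  nlinarith

/-- The layered map with linear profile, as an affine map. -/
noncomputable def layerAffineMap (k : ℝ) (e : Fin 3 → EuclideanSpace ℝ (Fin n)) :
    EuclideanSpace ℝ (Fin n) →ᵃ[ℝ] EuclideanSpace ℝ (Fin n) :=
  LinearMap.toAffineMap
    { toFun := layerMap k e id
      map_add' := fun x y => by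
        simp only [layerMap, layerIncrement, map_add, inner_add_right, id]
        module
      map_smul' := fun c x => by
        simp only [layerMap, layerIncrement, map_smul, inner_smul_right, id, smul_eq_mul,
          RingHom.id_apply]
        module }

lemma ae_layerHeight_ne (he : Orthonormal ℝ e) (c : ℝ) :
    ∀ᵐ x : EuclideanSpace ℝ (Fin n), layerHeight k e x ≠ c := by
  have hs : Function.Surjective (layerHeight k e).toLinearMap := fun t =>
    ⟨t • e 0, by simp [layerHeight_apply_zero he]⟩
  exact (ae_comp_linearMap_mem_iff (layerHeight k e).toLinearMap volume volume hs
    (measurableSet_singleton c).compl).2 (by simp [ae_iff])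

lemma ae_pointLinearDistortion_layerMap_le (he : Orthonormal ℝ e) (hk : 462 ≤ k) (j : ℕ) :
    ∀ᵐ x, pointLinearDistortion (layerMap k e (scaledSawtooth j)) x ≤ ENNReal.ofReal (k ^ 2) := by
  have hj : (j : ℝ) + 1 ≠ 0 := by positivity
  filter_upwards [ae_all_iff.2 fun m : ℤ => ae_layerHeight_ne (k := k) he ((m / 2 : ℝ) / (j + 1))]
    with x hx
  refine pointLinearDistortion_layerMap_le_sq he hk ?_
  refine (sawtooth_eventually_slope (s := (j + 1) * layerHeight k e x) fun m hm => hx m ?_).imp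
    (fun h => scaledSawtooth_eventually (by simpa using h)) fun h => scaledSawtooth_eventually h
  rw [← hm]
  field_simp

lemma isQuasiconformal_layerMap (he : Orthonormal ℝ e) (hk : 462 ≤ k) (j : ℕ) :
    IsQuasiconformal (k ^ 2) (layerMap k e (scaledSawtooth j)) where
  isHomeomorph := layerMap_isHomeomorph he (by linarith) (abs_scaledSawtooth_sub_le j)
  bounded := ⟨_, pointLinearDistortion_layerMap_le he (by linarith) (abs_scaledSawtooth_sub_le j)⟩
  linearDistortion_eq := by
    refine le_antisymm (essSup_le_of_ae_le _ (ae_pointLinearDistortion_layerMap_le he hk j)) ?_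
    have hj : (0 : ℝ) < j + 1 := by positivity
    have hc : Continuous fun x => ((j : ℝ) + 1) * layerHeight k e x := by fun_prop
    -- An open slab of slope 0 has positive measure, so the essential supremum is exactly `k ^ 2`.
    refine le_essSup_of_isOpen ((isOpen_Ioo (a := (-1 / 2 : ℝ)) (b := 0)).preimage hc)
      ⟨(-1 / 4 / ((j : ℝ) + 1)) • e 0, ?_⟩ fun x hx => ?_
    · rw [Set.mem_preimage, map_smul, layerHeight_apply_zero he, smul_eq_mul, mul_one,
        mul_div_cancel₀ _ hj.ne']
      constructor <;> norm_num
    · refine sq_le_pointLinearDistortion_layerMap he (scaledSawtooth_eventually ?_)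
      have := sawtooth_eventually_slope_zero (m := 0) (s := (j + 1) * layerHeight k e x)
        (by have := hx.1; norm_num at this ⊢; linarith) (by simpa using hx.2)
      simpa using this

lemma isQuasiconformal_layerAffineMap (he : Orthonormal ℝ e) (hk : 1 ≤ k) :
    ∃ K : ℝ, IsQuasiconformal K (layerAffineMap k e) ∧
      (∀ x, pointLinearDistortion (layerAffineMap k e) x = ENNReal.ofReal K) ∧ 2 * k ^ 2 ≤ K := by
  have hid : ∀ s t : ℝ, |id s - id t| ≤ 2 * |s - t| := fun s t => by
    simp only [id]; linarith [abs_nonneg (s - t)]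
  have hup := pointLinearDistortion_layerMap_le he hk hid
  have hfin : pointLinearDistortion (layerAffineMap k e) 0 ≠ ⊤ :=
    ((hup 0).trans_lt ENNReal.ofReal_lt_top).ne
  have hval : ∀ x, pointLinearDistortion (layerAffineMap k e) x =
      ENNReal.ofReal (pointLinearDistortion (layerAffineMap k e) 0).toReal := fun x => by
    rw [ENNReal.ofReal_toReal hfin, pointLinearDistortion_eq_zero_point]
  refine ⟨_, ⟨layerMap_isHomeomorph he hk hid, ⟨_, hup⟩, ?_⟩, hval, ?_⟩
  · exact (congrArg (essSup · volume) (funext hval)).trans (essSup_const _ (NeZero.ne volume))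
  · exact (ENNReal.ofReal_le_iff_le_toReal hfin).1
      (two_mul_sq_le_pointLinearDistortion_layerMap_id he hk 0)

lemma tendsto_layerMap_scaledSawtooth (k : ℝ) (e : Fin 3 → EuclideanSpace ℝ (Fin n)) :
    TendstoLocallyUniformly (fun j => layerMap k e (scaledSawtooth j)) (layerMap k e id) atTop := by
  refine TendstoUniformly.tendstoLocallyUniformly (Metric.tendstoUniformly_iff.2 fun ε hε => ?_)
  set a := -(k ^ 2 / 2) • e 0 + (4 * k ^ 2) • e 1 + (k / 2) • e 2 with ha
  have hlim : Tendsto (fun j : ℕ => 1 / ((j : ℝ) + 1) * ‖a‖) atTop (𝓝 0) := by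
    simpa using tendsto_one_div_add_atTop_nhds_zero_nat.mul_const ‖a‖
  filter_upwards [hlim.eventually_lt_const hε] with j hj x
  have h : layerMap k e (scaledSawtooth j) x - layerMap k e id x =
      (scaledSawtooth j (layerHeight k e x) - layerHeight k e x) • a := by
    simp only [layerMap, layerIncrement, id, ha]
    module
  rw [dist_comm, dist_eq_norm, h, norm_smul, Real.norm_eq_abs]
  exact (mul_le_mul_of_nonneg_right (abs_scaledSawtooth_sub_self_le j _)
    (norm_nonneg _)).trans_lt hj

end LayerDistortion

theorem mainTheorem2 (n : ℕ) (hn : 3 ≤ n) (α : ℝ) (hα : α < Real.sqrt 2) (M : ℝ) :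
    ∃ (H K : ℝ) (f : ℕ → EuclideanSpace ℝ (Fin n) → EuclideanSpace ℝ (Fin n))
      (A : EuclideanSpace ℝ (Fin n) →ᵃ[ℝ] EuclideanSpace ℝ (Fin n)),
      (∀ j, IsQuasiconformal H (f j)) ∧
      (∀ j, ∀ᵐ x, pointLinearDistortion (f j) x ≤ ENNReal.ofReal H) ∧
      TendstoLocallyUniformly f A atTop ∧
      IsQuasiconformal K A ∧
      (∀ x, pointLinearDistortion A x = ENNReal.ofReal K) ∧
      α * H ≤ K ∧
      M ≤ K - H := by
  let e : Fin 3 → EuclideanSpace ℝ (Fin n) :=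
    fun i => EuclideanSpace.basisFun (Fin n) ℝ (Fin.castLE hn i)
  have he : Orthonormal ℝ e :=
    (EuclideanSpace.basisFun (Fin n) ℝ).orthonormal.comp _ (Fin.castLE_injective hn)
  have hM := abs_nonneg M
  -- With this `k` the gap is at least `k ^ 2 ≥ k ≥ M`.
  have hk : 462 ≤ 462 + |M| := by linarith
  generalize hkM : 462 + |M| = k at hk
  obtain ⟨K, hK, hval, hle⟩ := isQuasiconformal_layerAffineMap he (show 1 ≤ k by linarith)
  refine ⟨k ^ 2, K, fun j => layerMap k e (scaledSawtooth j), layerAffineMap k e,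
    isQuasiconformal_layerMap he hk, ae_pointLinearDistortion_layerMap_le he hk,
    tendsto_layerMap_scaledSawtooth k e, hK, hval, ?_, ?_⟩
  · have h2 : Real.sqrt 2 ≤ 2 := Real.sqrt_le_iff.2 ⟨by norm_num, by norm_num⟩
    nlinarith [sq_nonneg k]
  · have := le_abs_self M
    nlinarith
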